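/- Let $d\ge 1$, let $(\Omega,\mathcal F,\mathbb P)$ be a probability space, and let $\mathcal L^d$ be the $\sigma$-algebra of Lebesgue measurable subsets of $\mathbb R^d$. Let $\{\tau_z\}_{z\in\mathbb R^d}$ be a measure-preserving, ergodic group action on $\Omega$, that is, a family of measurable maps $\tau_z:\Omega\to\Omega$ such that $(\omega,z)\mapsto\tau_z\omega$ is $\mathcal F\otimes\mathcal L^d$-$\mathcal F$-measurable, $\mathbb P(\tau_zF)=\mathbb P(F)$ for all $F\in\mathcal F$ and $z\in\mathbb R^d$, $\tau_0=\mathrm{id}_\Omega$, $\tau_{z_1+z_2}=\tau_{z_2}\circ\tau_{z_1}$ for all $z_1,z_2\in\mathbb R^d$, and such that every $F\in\mathcal F$ with $\mathbb P(\tau_zF\,\triangle\,F)=0$ for all $z\in\mathbb R^d$ satisfies $\mathbb P(F)\in\{0,1\}$. Let $D\subset\mathbb R^d$ be a bounded open set. Functions $u_\varepsilon$, $\varepsilon>0$, are said to converge weakly in $L^1(D)$ to $u$ as $\varepsilon\to0$ if $u\in L^1(D)$, $u_\varepsilon\in L^1(D)$ for all $\varepsilon>0$, and $\int_D\varphi u_\varepsilon\,\mathrm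 dx\to\int_D\varphi u\,\mathrm dx$ as $\varepsilon\to0$ for every $\varphi\in L^\infty(D)$. (1) For every $g\in L^1(\Omega)$ there is a set of $\omega\in\Omega$ of full probability on which the functions $x\mapsto g(\tau_{x/\varepsilon}\omega)$ converge weakly in $L^1(D)$ as $\varepsilon\to0$ to the constant function $\mathbb E[g]$; in particular, on this set, $$\lim_{\varepsilon\to0}\frac1{|E|}\int_E g(\tau_{x/\varepsilon}\omega)\,\mathrm dx=\mathbb E[g]\qquad\text{for every Borel set }E\subset D\text{ with }|E|>0.$$ (2) Let $p\in(1,\infty)$, and let $A$ and $\Lambda$ be $\mathcal F\otimes\mathcal L^d$-measurable functions on $\Omega\times\mathbb R^d$, where $A$ takes values in the real diagonal $d\times d$ matrices and $\Lambda$ in $[0,\infty)$. Let $|\cdot|$ be the operator norm of matrices induced by the Euclidean norm. Assume that $A(\cdot,0)$ is almost surely invertible, that $|A(\cdot,0)|^p$, $|A(\cdot,0)^{-1}|^{p/(p-1)}$ and $\Lambda(\cdot,0)$ belong to $L^1(\Omega)$, and that $A(\tau_z\omega,x)=A(\omega,x+z)$ and $\Lambda(\tau_z\omega,x)=\Lambda(\omega,x+z)$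 for all $z,x\in\mathbb R^d$ and $\omega\in\Omega$. Then for almost every $\omega\in\Omega$ the functions $x\mapsto|A(\omega,x/\varepsilon)|^p$, $x\mapsto|A(\omega,x/\varepsilon)^{-1}|^{p/(p-1)}$ and $x\mapsto\Lambda(\omega,x/\varepsilon)$ converge weakly in $L^1(D)$ as $\varepsilon\to0$ to the constant functions $\mathbb E[|A(\cdot,0)|^p]$, $\mathbb E[|A(\cdot,0)^{-1}|^{p/(p-1)}]$ and $\mathbb E[\Lambda(\cdot,0)]$, respectively. -/

import Mathlib

open MeasureTheory Filter Topology Set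

/-- The Euclidean space `ℝ^d`. -/
abbrev Rd (d : ℕ) : Type := EuclideanSpace ℝ (Fin d)

/-- `ℝ^d` with the `σ`-algebra of Lebesgue measurable sets (the completion of the Borel
`σ`-algebra with respect to Lebesgue measure). -/
abbrev RdLebesgue (d : ℕ) : Type := NullMeasurableSpace (Rd d) volume

/-- A measure-preserving additive group action `(τ_z)_{z ∈ ℝ^d}` on a measure space. -/
structure IsMeasurePreservingAction {d : ℕ} {Ω : Type*} [MeasurableSpace Ω] (P : Measure Ω)
    (τ : Rd d → Ω → Ω) : Prop where
  measurable : ∀ z, Measurable (τ z)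
  jointlyMeasurable : Measurable (fun q : Ω × RdLebesgue d => τ q.2 q.1)
  measure_image : ∀ (z : Rd d) (F : Set Ω), MeasurableSet F → P (τ z '' F) = P F
  zero : τ 0 = id
  add : ∀ z₁ z₂ : Rd d, τ (z₁ + z₂) = τ z₂ ∘ τ z₁

/-- A measure-preserving group action is ergodic if every measurable set that is invariant up to
null sets under each `τ_z` has probability zero or one. -/
structure IsErgodicAction {d : ℕ} {Ω : Type*} [MeasurableSpace Ω] (P : Measure Ω)
    (τ : Rd d → Ω → Ω) : Prop extends IsMeasurePreservingAction P τ where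
  ergodic : ∀ F : Set Ω, MeasurableSet F → (∀ z : Rd d, P (symmDiff (τ z '' F) F) = 0) →
    P F = 0 ∨ P F = 1

/-- Weak convergence in `L¹(D)` of a family `(u_ε)_{ε > 0}` to `u` as `ε → 0`: all functions belong
to `L¹(D)`, and the integrals against every `φ ∈ L^∞(D)` converge. -/
def WeakL1Tendsto {d : ℕ} (D : Set (Rd d)) (u : ℝ → Rd d → ℝ) (u₀ : Rd d → ℝ) : Prop :=
  (∀ ε : ℝ, 0 < ε → IntegrableOn (u ε) D volume) ∧ IntegrableOn u₀ D volume ∧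
    ∀ φ : Rd d → ℝ, MemLp φ ⊤ (volume.restrict D) →
      Tendsto (fun ε => ∫ x in D, φ x * u ε x) (𝓝[>] 0) (𝓝 (∫ x in D, φ x * u₀ x))

/-- The norm of a real matrix as a linear operator on Euclidean space. -/
noncomputable def matOpNorm {d : ℕ} (M : Matrix (Fin d) (Fin d) ℝ) : ℝ :=
  ‖Matrix.toEuclideanCLM (n := Fin d) (𝕜 := ℝ) M‖

/-- The assumptions on the random weights `A` (with values in the diagonal matrices) and `Λ`:
joint measurability, the integrability conditions with exponent `p`, and stationarity with respect
to `τ`. Almost sure invertibility of `A(·,0)` is what gives a meaning to the integrability of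
`|A(·,0)⁻¹|^{p/(p-1)}`. -/
structure IsStationaryWeight {d : ℕ} {Ω : Type*} [MeasurableSpace Ω] (P : Measure Ω)
    (τ : Rd d → Ω → Ω) (p : ℝ) (A : Ω → Rd d → Matrix (Fin d) (Fin d) ℝ)
    (Λ : Ω → Rd d → ℝ) : Prop where
  isDiag : ∀ ω x, (A ω x).IsDiag
  nonneg : ∀ ω x, 0 ≤ Λ ω x
  measurable_A : ∀ i j, Measurable (fun q : Ω × RdLebesgue d => A q.1 q.2 i j)
  measurable_Λ : Measurable (fun q : Ω × RdLebesgue d => Λ q.1 q.2)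
  invertible : ∀ᵐ ω ∂P, IsUnit (A ω 0)
  integrable_A : Integrable (fun ω => matOpNorm (A ω 0) ^ p) P
  integrable_A_inv : Integrable (fun ω => matOpNorm ((A ω 0)⁻¹) ^ (p / (p - 1))) P
  integrable_Λ : Integrable (fun ω => Λ ω 0) P
  stationary_A : ∀ z ω x, A (τ z ω) x = A ω (x + z)
  stationary_Λ : ∀ z ω x, Λ (τ z ω) x = Λ ω (x + z)

/-!
The proof is a pointwise ergodic theorem for actions of `ℝ^d`, in the form of weak convergence of the
rescaled orbit functions `x ↦ f (τ_{x/ε} ω)`. It combines a maximal inequality with a dense class of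
observables on which convergence is elementary.

*Dense class.* For constants there is nothing to prove. For a coboundary `h - h ∘ τ_z` with `h`
bounded, a change of variables moves the translation to the test function: the integral against `φ`
is at most `sup |h|` times `‖φ - φ(· - ε z)‖_{L¹}`, which vanishes as `ε → 0` for *every* `ω` and
*every* `φ` (`weakL1Tendsto_sub_translate`). Since `φ` is arbitrary at this point, no separability of
the space of test functions is needed. Coboundaries of indicators together with the constants span a
dense subspace of `L²(Ω)`: a function orthogonal to them is invariant, so constant by ergodicity, so
zero (`HasWeakErgodicLimit.submodule_eq_top`).

*Maximal inequality.* The Vitali covering lemma gives the Hardy–Littlewood inequality in `ℝ^d`, and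
integrating it over orbits transfers it to `Ω`
(`IsMeasurePreservingAction.mul_measure_exists_lt_lintegral_orbit_le`). As `D` is bounded, the means
of `|f|` over orbit balls control `∫_D φ(x) f(τ_{x/ε} ω) dx` uniformly in `ε`, so the observables for
which the theorem holds form a closed subset of `L¹(Ω)` (`HasWeakErgodicLimit.of_tendsto`). Dyadic
radii suffice, which keeps the maximal function null-measurable.

The action is measurable only for the Lebesgue `σ`-algebra on `ℝ^d`; throughout, `(ω, x) ↦ τ_x ω` is
treated as a null-measurable map for the product of `P` and Lebesgue measure. The statement on
stationary weights is the case of the observables `|A(·,0)|^p`, `|A(·,0)⁻¹|^{p/(p-1)}`, `Λ(·,0)`.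
-/

open scoped ENNReal NNReal

/-! ### Orbits of the action -/

namespace IsMeasurePreservingAction

variable {d : ℕ} {Ω : Type*} [MeasurableSpace Ω] {P : Measure Ω} {τ : Rd d → Ω → Ω}

theorem image_eq_preimage_neg (hτ : IsMeasurePreservingAction P τ) (z : Rd d) (F : Set Ω) :
    τ z '' F = τ (-z) ⁻¹' F := by
  have h1 : Function.LeftInverse (τ (-z)) (τ z) := fun ω => by
    have := congrFun (hτ.add z (-z)) ω
    simpa [hτ.zero] using this.symm
  have h2 : Function.RightInverse (τ (-z)) (τ z) := fun ω => by
    have := congrFun (hτ.add (-z) z) ω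
    simpa [hτ.zero] using this.symm
  exact congrFun (image_eq_preimage_of_inverse h1 h2) F

theorem measurePreserving (hτ : IsMeasurePreservingAction P τ) (z : Rd d) :
    MeasurePreserving (τ z) P P := by
  refine ⟨hτ.measurable z, Measure.ext fun F hF => ?_⟩
  rw [Measure.map_apply (hτ.measurable z) hF, ← hτ.measure_image (-z) F hF,
    hτ.image_eq_preimage_neg, neg_neg]

theorem setIntegral_preimage_comp (hτ : IsMeasurePreservingAction P τ) (z : Rd d) {f : Ω → ℝ}
    (hf : AEStronglyMeasurable f P) {F : Set Ω} (hF : MeasurableSet F) :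
    ∫ ω in τ z ⁻¹' F, f (τ z ω) ∂P = ∫ ω in F, f ω ∂P := by
  have hmp := hτ.measurePreserving z
  have h := setIntegral_map (μ := P) (f := f) hF (by rwa [hmp.map_eq]) hmp.measurable.aemeasurable
  rw [← h, hmp.map_eq]

/-- Although `(ω, x) ↦ τ_x ω` is only measurable for the Lebesgue `σ`-algebra in `x`, it is
null-measurable for the product of the Borel structures, since `F ⊗ L^d` lies in the completion of
`F ⊗ B^d`. -/
theorem nullMeasurable_orbit [SFinite P] (hτ : IsMeasurePreservingAction P τ) :
    NullMeasurable (fun q : Ω × Rd d => τ q.2 q.1) (P.prod volume) := by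
  have h : @Measurable (NullMeasurableSpace (Ω × Rd d) (P.prod volume)) (Ω × RdLebesgue d) _ _
      (fun q : Ω × Rd d => ((q.1, q.2) : Ω × Rd d)) := by
    refine Measurable.prodMk (f := fun q : Ω × Rd d => q.1)
      (g := fun q : Ω × Rd d => (q.2 : RdLebesgue d)) ?_ ?_
    · intro s hs
      exact (measurable_fst hs).nullMeasurableSet
    · intro s hs
      exact NullMeasurableSet.preimage (s := s) (μb := volume) hs Measure.quasiMeasurePreserving_snd
  exact hτ.jointlyMeasurable.comp h

theorem nullMeasurable_orbit_right (hτ : IsMeasurePreservingAction P τ) (ω : Ω) :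
    NullMeasurable (fun x : Rd d => τ x ω) volume :=
  hτ.jointlyMeasurable.comp (measurable_const.prodMk (measurable_id (α := RdLebesgue d)))

/-- A null set of `Ω` is visited by almost no orbit point. -/
theorem ae_orbit [SFinite P] (hτ : IsMeasurePreservingAction P τ) {p : Ω → Prop}
    (hp : ∀ᵐ ω ∂P, p ω) : ∀ᵐ q ∂(P.prod (volume : Measure (Rd d))), p (τ q.2 q.1) := by
  obtain ⟨N, hpN, hN, hN0⟩ := exists_measurable_superset_of_null (ae_iff.1 hp)
  have hnull : P.prod (volume : Measure (Rd d)) ((fun q : Ω × Rd d => τ q.2 q.1) ⁻¹' N) = 0 := by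
    have hm := hτ.nullMeasurable_orbit hN
    rw [← lintegral_indicator_one₀ hm]
    refine (lintegral_prod_symm _ ((aemeasurable_indicator_const_iff 1).2 hm)).trans ?_
    refine (lintegral_congr fun x => ?_).trans lintegral_zero
    change ∫⁻ ω, ((τ x ⁻¹' N).indicator 1 ω) ∂P = 0
    rw [lintegral_indicator_one (hτ.measurable x hN),
      (hτ.measurePreserving x).measure_preimage hN.nullMeasurableSet, hN0]
  refine measure_mono_null (fun q hq => hpN hq) hnull

theorem ae_ae_orbit [SFinite P] (hτ : IsMeasurePreservingAction P τ) {p : Ω → Prop}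
    (hp : ∀ᵐ ω ∂P, p ω) : ∀ᵐ ω ∂P, ∀ᵐ x : Rd d, p (τ x ω) :=
  Measure.ae_ae_of_ae_prod (hτ.ae_orbit hp)

theorem aemeasurable_comp_orbit [SFinite P] (hτ : IsMeasurePreservingAction P τ) {β : Type*}
    [MeasurableSpace β] [MeasurableSpace.CountablyGenerated β] {g : Ω → β}
    (hg : AEMeasurable g P) :
    AEMeasurable (fun q : Ω × Rd d => g (τ q.2 q.1)) (P.prod volume) := by
  have h : NullMeasurable (fun q : Ω × Rd d => hg.mk g (τ q.2 q.1)) (P.prod volume) :=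
    fun s hs => hτ.nullMeasurable_orbit (hg.measurable_mk hs)
  exact h.aemeasurable.congr ((hτ.ae_orbit hg.ae_eq_mk).mono fun q hq => hq.symm)

theorem aemeasurable_comp_orbit_right (hτ : IsMeasurePreservingAction P τ) {β : Type*}
    [MeasurableSpace β] [MeasurableSpace.CountablyGenerated β] {g : Ω → β}
    (hg : Measurable g) (ω : Ω) : AEMeasurable (fun x : Rd d => g (τ x ω)) volume :=
  NullMeasurable.aemeasurable fun _ hs => hτ.nullMeasurable_orbit_right ω (hg hs)

theorem aemeasurable_comp_orbit_prod_restrict [SFinite P] (hτ : IsMeasurePreservingAction P τ)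
    {g : Ω → ℝ≥0∞} (hg : AEMeasurable g P) (B : Set (Rd d)) :
    AEMeasurable (fun q : Ω × Rd d => g (τ q.2 q.1)) (P.prod (volume.restrict B)) :=
  (hτ.aemeasurable_comp_orbit hg).mono_ac
    (Measure.AbsolutelyContinuous.rfl.prod Measure.restrict_le_self.absolutelyContinuous)

theorem aemeasurable_lintegral_orbit [SFinite P] (hτ : IsMeasurePreservingAction P τ)
    {g : Ω → ℝ≥0∞} (hg : AEMeasurable g P) (B : Set (Rd d)) :
    AEMeasurable (fun ω => ∫⁻ x in B, g (τ x ω)) P :=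
  (hτ.aemeasurable_comp_orbit_prod_restrict hg B).lintegral_prod_right'

/-- Tonelli's theorem along the orbits. -/
theorem lintegral_lintegral_orbit [SFinite P] (hτ : IsMeasurePreservingAction P τ)
    {g : Ω → ℝ≥0∞} (hg : AEMeasurable g P) (B : Set (Rd d)) :
    ∫⁻ ω, (∫⁻ x in B, g (τ x ω)) ∂P = volume B * ∫⁻ ω, g ω ∂P := by
  have h := hτ.aemeasurable_comp_orbit_prod_restrict hg B
  rw [← lintegral_prod _ h, lintegral_prod_symm _ h]
  have hx : ∀ x : Rd d, ∫⁻ ω, g (τ x ω) ∂P = ∫⁻ ω, g ω ∂P := fun x => by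
    have hmp := hτ.measurePreserving x
    have := lintegral_map' (f := g) (by rwa [hmp.map_eq]) hmp.measurable.aemeasurable
    rw [← this, hmp.map_eq]
  simp only [hx, lintegral_const, Measure.restrict_apply_univ]
  rw [mul_comm]

theorem ae_integrableOn_closedBall [SFinite P] (hτ : IsMeasurePreservingAction P τ)
    {g : Ω → ℝ} (hg : Integrable g P) :
    ∀ᵐ ω ∂P, ∀ r : ℝ, IntegrableOn (fun x => g (τ x ω)) (Metric.closedBall (0 : Rd d) r) := by
  have hae : ∀ᵐ ω ∂P, AEMeasurable (fun x : Rd d => g (τ x ω)) volume := by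
    filter_upwards [hτ.ae_ae_orbit hg.aemeasurable.ae_eq_mk] with ω hω
    exact (hτ.aemeasurable_comp_orbit_right hg.aemeasurable.measurable_mk ω).congr
      (hω.mono fun x hx => hx.symm)
  have hfin : ∀ᵐ ω ∂P, ∀ n : ℕ, ∫⁻ x in Metric.closedBall (0 : Rd d) n, ‖g (τ x ω)‖ₑ < ∞ := by
    refine ae_all_iff.2 fun n =>
      ae_lt_top' (hτ.aemeasurable_lintegral_orbit hg.aemeasurable.enorm _) ?_
    rw [hτ.lintegral_lintegral_orbit hg.aemeasurable.enorm]
    exact (ENNReal.mul_lt_top measure_closedBall_lt_top hg.2).ne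
  filter_upwards [hae, hfin] with ω h1 h2 r
  obtain ⟨n, hn⟩ := exists_nat_ge r
  have : IntegrableOn (fun x => g (τ x ω)) (Metric.closedBall (0 : Rd d) n) :=
    ⟨h1.aestronglyMeasurable.restrict, h2 n⟩
  exact this.mono_set (Metric.closedBall_subset_closedBall hn)

end IsMeasurePreservingAction

/-! ### The maximal inequality -/

/-- The Hardy–Littlewood maximal inequality in `ℝ^d`, localised to a ball and to radii at most `R`;
no measurability of `f` is needed. -/
theorem mul_volume_exists_lt_lintegral_closedBall_le {d : ℕ} (f : Rd d → ℝ≥0∞) (c : ℝ≥0∞)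
    (L R : ℝ) :
    c * volume {x ∈ Metric.closedBall (0 : Rd d) L | ∃ r, 0 < r ∧ r ≤ R ∧
        c * volume (Metric.closedBall x r) < ∫⁻ y in Metric.closedBall x r, f y} ≤
      ENNReal.ofReal (5 ^ d) * ∫⁻ y in Metric.closedBall (0 : Rd d) (L + R), f y := by
  set S := {x ∈ Metric.closedBall (0 : Rd d) L | ∃ r, 0 < r ∧ r ≤ R ∧
        c * volume (Metric.closedBall x r) < ∫⁻ y in Metric.closedBall x r, f y} with hS
  have hex : ∀ x : S, ∃ r, 0 < r ∧ r ≤ R ∧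
      c * volume (Metric.closedBall (x : Rd d) r) < ∫⁻ y in Metric.closedBall (x : Rd d) r, f y :=
    fun x => x.2.2
  choose r hr0 hrR hr using hex
  obtain ⟨u, -, hud, hcov⟩ := Vitali.exists_disjoint_subfamily_covering_enlargement_closedBall
    (univ : Set S) (fun x => (x : Rd d)) r R (fun x _ => hrR x) 5 (by norm_num)
  have hucount : u.Countable := by
    refine hud.countable_of_nonempty_interior fun x _ => ?_
    exact ⟨x, Metric.ball_subset_interior_closedBall (Metric.mem_ball_self (hr0 x))⟩
  have hsub : S ⊆ ⋃ b ∈ u, Metric.closedBall (b : Rd d) (5 * r b) := fun x hx => by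
    obtain ⟨b, hb, hb'⟩ := hcov ⟨x, hx⟩ (mem_univ _)
    exact mem_biUnion hb (hb' (Metric.mem_closedBall_self (hr0 _).le))
  calc c * volume S
      ≤ c * ∑' b : u, volume (Metric.closedBall ((b : S) : Rd d) (5 * r b)) := by
        gcongr
        exact (measure_mono hsub).trans (measure_biUnion_le _ hucount _)
    _ = ∑' b : u, ENNReal.ofReal (5 ^ d) *
          (c * volume (Metric.closedBall ((b : S) : Rd d) (r b))) := by
        rw [← ENNReal.tsum_mul_left]
        refine tsum_congr fun b => ?_
        rw [Measure.addHaar_closedBall_mul_of_pos _ _ (by norm_num), finrank_euclideanSpace_fin,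
          Measure.addHaar_closedBall_center _ ((b : S) : Rd d) (r b)]
        ring
    _ ≤ ∑' b : u, ENNReal.ofReal (5 ^ d) *
          ∫⁻ y in Metric.closedBall ((b : S) : Rd d) (r b), f y :=
        ENNReal.tsum_le_tsum fun b => by gcongr; exact (hr b).le
    _ = ENNReal.ofReal (5 ^ d) *
          ∫⁻ y in ⋃ b ∈ u, Metric.closedBall ((b : S) : Rd d) (r b), f y := by
        rw [ENNReal.tsum_mul_left,
          lintegral_biUnion hucount (fun _ _ => Metric.isClosed_closedBall.measurableSet) hud]
    _ ≤ _ := by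
        gcongr
        refine iUnion₂_subset fun b _ => Metric.closedBall_subset_closedBall' ?_
        have := b.2.1
        rw [Metric.mem_closedBall] at this
        linarith [hrR b]

namespace IsMeasurePreservingAction

variable {d : ℕ} {Ω : Type*} [MeasurableSpace Ω] {P : Measure Ω} {τ : Rd d → Ω → Ω}

theorem setLIntegral_orbit_comp (hτ : IsMeasurePreservingAction P τ) (g : Ω → ℝ≥0∞) (r : ℝ)
    (x : Rd d) (ω : Ω) :
    ∫⁻ y in Metric.closedBall 0 r, g (τ y (τ x ω)) = ∫⁻ y in Metric.closedBall x r, g (τ y ω) := by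
  have h := (measurePreserving_add_left volume x).setLIntegral_comp_preimage_emb
    (measurableEmbedding_addLeft x) (fun y => g (τ y ω)) (Metric.closedBall x r)
  rw [← h, preimage_add_closedBall, sub_self]
  simp only [hτ.add, Function.comp_apply]

/-- Wiener's maximal inequality for ball averages over dyadic radii, obtained from the
Hardy–Littlewood inequality along orbits by transference. -/
theorem mul_measure_exists_lt_lintegral_orbit_le [IsProbabilityMeasure P]
    (hτ : IsMeasurePreservingAction P τ) {g : Ω → ℝ≥0∞} (hg : AEMeasurable g P) (c : ℝ≥0∞) :
    c * P {ω | ∃ n : ℕ, c * volume (Metric.closedBall (0 : Rd d) (2 ^ n)) <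
        ∫⁻ x in Metric.closedBall (0 : Rd d) (2 ^ n), g (τ x ω)} ≤
      ENNReal.ofReal (10 ^ d) * ∫⁻ ω, g ω ∂P := by
  set E : ℕ → Set Ω := fun N => {ω | ∃ n ≤ N, c * volume (Metric.closedBall (0 : Rd d) (2 ^ n)) <
        ∫⁻ x in Metric.closedBall (0 : Rd d) (2 ^ n), g (τ x ω)} with hE
  have hmono : Monotone E := fun N M h ω ⟨n, hn, hω⟩ => ⟨n, hn.trans h, hω⟩
  have hunion : {ω | ∃ n : ℕ, c * volume (Metric.closedBall (0 : Rd d) (2 ^ n)) <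
        ∫⁻ x in Metric.closedBall (0 : Rd d) (2 ^ n), g (τ x ω)} = ⋃ N, E N := by
    ext ω
    simp only [mem_ofPred_eq, mem_iUnion, hE]
    exact ⟨fun ⟨n, hn⟩ => ⟨n, n, le_rfl, hn⟩, fun ⟨_, n, _, hn⟩ => ⟨n, hn⟩⟩
  rw [hunion, hmono.measure_iUnion, ENNReal.mul_iSup]
  refine iSup_le fun N => ?_
  have hEm : NullMeasurableSet (E N) P := by
    have : E N = ⋃ n ∈ Iic N, {ω | c * volume (Metric.closedBall (0 : Rd d) (2 ^ n)) <
        ∫⁻ x in Metric.closedBall (0 : Rd d) (2 ^ n), g (τ x ω)} := by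
      ext ω; simp [hE]
    rw [this]
    refine NullMeasurableSet.biUnion (finite_Iic N).countable fun n _ => ?_
    exact nullMeasurableSet_lt aemeasurable_const (hτ.aemeasurable_lintegral_orbit hg _)
  have hind : AEMeasurable ((E N).indicator (1 : Ω → ℝ≥0∞)) P :=
    (aemeasurable_indicator_const_iff 1).2 hEm
  -- the ball in which the base points vary has the same radius as the largest averaging ball
  set V := volume (Metric.closedBall (0 : Rd d) (2 ^ N)) with hV
  have hV0 : V ≠ 0 := (Metric.measure_closedBall_pos _ _ (by positivity)).ne'
  have hVt : V ≠ ∞ := measure_closedBall_lt_top.ne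
  have hV2 : volume (Metric.closedBall (0 : Rd d) (2 ^ N + 2 ^ N)) = ENNReal.ofReal (2 ^ d) * V := by
    rw [← two_mul, Measure.addHaar_closedBall_mul_of_pos _ _ (by norm_num),
      finrank_euclideanSpace_fin]
  have key : c * (V * P (E N)) ≤ V * (ENNReal.ofReal (10 ^ d) * ∫⁻ ω, g ω ∂P) := by
    calc c * (V * P (E N))
        = c * ∫⁻ ω, (∫⁻ x in Metric.closedBall (0 : Rd d) (2 ^ N),
            (E N).indicator 1 (τ x ω)) ∂P := by
          rw [hτ.lintegral_lintegral_orbit hind, lintegral_indicator_one₀ hEm]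
      _ = ∫⁻ ω, c * (∫⁻ x in Metric.closedBall (0 : Rd d) (2 ^ N),
            (E N).indicator 1 (τ x ω)) ∂P := by
          rw [lintegral_const_mul'' _ (hτ.aemeasurable_lintegral_orbit hind _)]
      _ ≤ ∫⁻ ω, ENNReal.ofReal (5 ^ d) *
            (∫⁻ x in Metric.closedBall (0 : Rd d) (2 ^ N + 2 ^ N), g (τ x ω)) ∂P := by
          refine lintegral_mono fun ω => ?_
          refine le_trans ?_ (mul_volume_exists_lt_lintegral_closedBall_le
            (fun x => g (τ x ω)) c (2 ^ N) (2 ^ N))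
          gcongr
          change ∫⁻ x in Metric.closedBall (0 : Rd d) (2 ^ N),
            ((fun x => τ x ω) ⁻¹' E N).indicator (fun _ => 1) x ≤ _
          refine (lintegral_indicator_const_le _ _).trans ?_
          rw [one_mul, Measure.restrict_apply' Metric.isClosed_closedBall.measurableSet]
          refine measure_mono fun x ⟨⟨n, hn, hx⟩, hxL⟩ => ⟨hxL, 2 ^ n, by positivity, ?_, ?_⟩
          · exact pow_le_pow_right₀ (by norm_num) hn
          · rwa [hτ.setLIntegral_orbit_comp, ← Measure.addHaar_closedBall_center _ x] at hx
      _ = V * (ENNReal.ofReal (10 ^ d) * ∫⁻ ω, g ω ∂P) := by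
          rw [lintegral_const_mul'' _ (hτ.aemeasurable_lintegral_orbit hg _),
            hτ.lintegral_lintegral_orbit hg, hV2, show (10 : ℝ) ^ d = 5 ^ d * 2 ^ d by
              rw [← mul_pow]; norm_num, ENNReal.ofReal_mul (by positivity)]
          ring
  rw [mul_left_comm] at key
  exact (ENNReal.mul_le_mul_iff_right hV0 hVt).1 key

/-- An almost sure consequence of the maximal inequality: if the means of the `g k` tend to zero,
then almost surely some `g k` with `k` large has small mean over all dyadic balls of the orbit. -/
theorem ae_exists_forall_lintegral_orbit_le
    [IsProbabilityMeasure P] (hτ : IsMeasurePreservingAction P τ) {g : ℕ → Ω → ℝ≥0∞}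
    (hg : ∀ k, AEMeasurable (g k) P) (hlim : Tendsto (fun k => ∫⁻ ω, g k ω ∂P) atTop (𝓝 0))
    {c : ℝ≥0∞} (hc : c ≠ 0) (m : ℕ) :
    ∀ᵐ ω ∂P, ∃ k ≥ m, ∀ n : ℕ, ∫⁻ x in Metric.closedBall (0 : Rd d) (2 ^ n), g k (τ x ω) ≤
      c * volume (Metric.closedBall (0 : Rd d) (2 ^ n)) := by
  set S := {ω | ¬ ∃ k ≥ m, ∀ n : ℕ, ∫⁻ x in Metric.closedBall (0 : Rd d) (2 ^ n), g k (τ x ω) ≤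
      c * volume (Metric.closedBall (0 : Rd d) (2 ^ n))} with hS
  change P S = 0
  have hbound : ∀ k ≥ m, c * P S ≤ ENNReal.ofReal (10 ^ d) * ∫⁻ ω, g k ω ∂P := fun k hk => by
    refine le_trans ?_ (hτ.mul_measure_exists_lt_lintegral_orbit_le (hg k) c)
    gcongr
    intro ω hω
    simp only [hS, mem_ofPred_eq, not_exists, not_and, not_forall, not_le] at hω
    exact hω k hk
  have h0 : c * P S ≤ 0 := by
    have h := ENNReal.Tendsto.const_mul hlim (Or.inr (ENNReal.ofReal_ne_top (r := 10 ^ d)))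
    rw [mul_zero] at h
    exact ge_of_tendsto h (eventually_atTop.2 ⟨m, hbound⟩)
  simpa [hc] using h0

end IsMeasurePreservingAction

/-! ### Weak convergence in `L¹` of rescaled functions -/

namespace WeakL1Tendsto

variable {d : ℕ} {D : Set (Rd d)}

theorem add {u v : ℝ → Rd d → ℝ} {u₀ v₀ : Rd d → ℝ} (hu : WeakL1Tendsto D u u₀)
    (hv : WeakL1Tendsto D v v₀) :
    WeakL1Tendsto D (fun ε x => u ε x + v ε x) (fun x => u₀ x + v₀ x) := by
  refine ⟨fun ε hε => (hu.1 ε hε).add (hv.1 ε hε), hu.2.1.add hv.2.1, fun φ hφ => ?_⟩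
  have hi : ∀ {w : Rd d → ℝ}, IntegrableOn w D → IntegrableOn (fun x => φ x * w x) D :=
    fun hw => Integrable.mul_of_top_right hw hφ
  simp only [mul_add]
  rw [integral_add (hi hu.2.1) (hi hv.2.1)]
  refine ((hu.2.2 φ hφ).add (hv.2.2 φ hφ)).congr' ?_
  filter_upwards [self_mem_nhdsWithin] with ε hε
  rw [integral_add (hi (hu.1 ε hε)) (hi (hv.1 ε hε))]

theorem const_mul {u : ℝ → Rd d → ℝ} {u₀ : Rd d → ℝ} (hu : WeakL1Tendsto D u u₀) (c : ℝ) :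
    WeakL1Tendsto D (fun ε x => c * u ε x) (fun x => c * u₀ x) := by
  refine ⟨fun ε hε => (hu.1 ε hε).const_mul c, hu.2.1.const_mul c, fun φ hφ => ?_⟩
  simp only [mul_left_comm _ c, integral_const_mul]
  exact (hu.2.2 φ hφ).const_mul c

theorem congr_ae {u v : ℝ → Rd d → ℝ} {u₀ : Rd d → ℝ} (hu : WeakL1Tendsto D u u₀)
    (h : ∀ ε, 0 < ε → u ε =ᵐ[volume.restrict D] v ε) : WeakL1Tendsto D v u₀ := by
  refine ⟨fun ε hε => (hu.1 ε hε).congr (h ε hε), hu.2.1, fun φ hφ => ?_⟩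
  refine (hu.2.2 φ hφ).congr' ?_
  filter_upwards [self_mem_nhdsWithin] with ε hε
  exact integral_congr_ae ((h ε hε).mono fun x hx => by simp only [hx])

/-- Testing with indicator functions gives the convergence of averages. -/
theorem tendsto_average {u : ℝ → Rd d → ℝ} {c : ℝ} (hu : WeakL1Tendsto D u fun _ => c)
    (hD : Bornology.IsBounded D) {E : Set (Rd d)} (hED : E ⊆ D) (hE : MeasurableSet E)
    (hE0 : 0 < volume E) : Tendsto (fun ε => ⨍ x in E, u ε x) (𝓝[>] 0) (𝓝 c) := by
  have hint : ∀ w : Rd d → ℝ,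
      ∫ x in D, E.indicator (fun _ => (1 : ℝ)) x * w x = ∫ x in E, w x := fun w => by
    have h1 : ∀ x, E.indicator (fun _ => (1 : ℝ)) x * w x = E.indicator w x := fun x => by
      by_cases hx : x ∈ E <;> simp [hx]
    simp only [h1]
    rw [setIntegral_indicator hE, inter_eq_right.2 hED]
  have hφ : MemLp (E.indicator fun _ => (1 : ℝ)) ⊤ (volume.restrict D) :=
    memLp_top_of_bound (stronglyMeasurable_const.indicator hE).aestronglyMeasurable 1
      (Eventually.of_forall fun x => by by_cases hx : x ∈ E <;> simp [hx])
  have h := hu.2.2 _ hφ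
  simp only [hint] at h
  have hV : volume.real E ≠ 0 :=
    (ENNReal.toReal_pos hE0.ne' (hD.subset hED).measure_lt_top.ne).ne'
  simp only [setAverage_eq]
  convert h.const_smul (volume.real E)⁻¹ using 2
  rw [setIntegral_const, smul_smul, inv_mul_cancel₀ hV, one_smul]

end WeakL1Tendsto

theorem integrableOn_comp_inv_smul {d : ℕ} {u : Rd d → ℝ} {D : Set (Rd d)}
    (hu : ∀ r : ℝ, IntegrableOn u (Metric.closedBall 0 r)) (hD : Bornology.IsBounded D) {ε : ℝ}
    (hε : 0 < ε) : IntegrableOn (fun x => u (ε⁻¹ • x)) D := by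
  obtain ⟨R, hR⟩ := hD.subset_closedBall 0
  have h1 := (integrable_indicator_iff Metric.isClosed_closedBall.measurableSet).2 (hu (ε⁻¹ * R))
  have h2 := (integrable_comp_smul_iff volume _ (inv_ne_zero hε.ne')).2 h1
  have h3 : IntegrableOn (fun x => u (ε⁻¹ • x))
      ((fun x : Rd d => ε⁻¹ • x) ⁻¹' Metric.closedBall 0 (ε⁻¹ * R)) :=
    (integrable_indicator_iff
      (Metric.isClosed_closedBall.measurableSet.preimage (measurable_const_smul _))).1 h2
  refine h3.mono_set fun x hx => ?_
  have := hR hx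
  rw [mem_closedBall_zero_iff] at this
  rw [mem_preimage, mem_closedBall_zero_iff, norm_smul, Real.norm_of_nonneg (by positivity)]
  gcongr

/-- A bound on the mean of `|h|` over all dyadic balls bounds the integrals of the rescalings of
`h` over a fixed bounded set. -/
theorem setLIntegral_comp_inv_smul_le {d : ℕ} {h : Rd d → ℝ≥0∞} {c : ℝ≥0∞}
    (hh : ∀ n : ℕ, ∫⁻ x in Metric.closedBall (0 : Rd d) (2 ^ n), h x ≤
      c * volume (Metric.closedBall (0 : Rd d) (2 ^ n)))
    {D : Set (Rd d)} {R : ℝ} (hD : D ⊆ Metric.closedBall 0 R) {ε : ℝ} (hε : 0 < ε) (hεR : ε ≤ R) :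
    ∫⁻ x in D, h (ε⁻¹ • x) ≤ c * volume (Metric.closedBall (0 : Rd d) (2 * R)) := by
  have hR : 0 < R := hε.trans_le hεR
  obtain ⟨n, hn1, hn2⟩ := exists_nat_pow_near (one_le_div hε |>.2 hεR) (one_lt_two (α := ℝ))
  set B := Metric.closedBall (0 : Rd d) (2 ^ (n + 1)) with hB
  have hsub : D ⊆ (fun x : Rd d => ε⁻¹ • x) ⁻¹' B := fun x hx => by
    have := hD hx
    rw [mem_closedBall_zero_iff] at this
    rw [mem_preimage, hB, mem_closedBall_zero_iff, norm_smul, Real.norm_of_nonneg (by positivity)]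
    calc ε⁻¹ * ‖x‖ ≤ ε⁻¹ * R := by gcongr
      _ = R / ε := by ring
      _ ≤ _ := hn2.le
  have hemb : MeasurableEmbedding (fun x : Rd d => ε⁻¹ • x) :=
    (Homeomorph.smulOfNeZero ε⁻¹ (inv_ne_zero hε.ne')).measurableEmbedding
  have hpow : 0 < ε ^ d := by positivity
  calc ∫⁻ x in D, h (ε⁻¹ • x)
      ≤ ∫⁻ x in (fun x : Rd d => ε⁻¹ • x) ⁻¹' B, h (ε⁻¹ • x) := lintegral_mono_set hsub
    _ = ∫⁻ y in B, h y ∂(Measure.map (fun x : Rd d => ε⁻¹ • x) volume) := by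
        rw [hemb.restrict_map, hemb.lintegral_map]
    _ = ENNReal.ofReal (ε ^ d) * ∫⁻ y in B, h y := by
        rw [Measure.map_addHaar_smul _ (inv_ne_zero hε.ne'), Measure.restrict_smul,
          lintegral_smul_measure, finrank_euclideanSpace_fin, smul_eq_mul, inv_pow, inv_inv,
          abs_of_pos hpow]
    _ ≤ ENNReal.ofReal (ε ^ d) * (c * volume (Metric.closedBall (0 : Rd d) (ε⁻¹ * (2 * R)))) := by
        gcongr
        refine (hh (n + 1)).trans ?_
        gcongr
        calc (2 : ℝ) ^ (n + 1) = 2 * 2 ^ n := by ring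
          _ ≤ 2 * (R / ε) := by gcongr
          _ = ε⁻¹ * (2 * R) := by ring
    _ = c * volume (Metric.closedBall (0 : Rd d) (2 * R)) := by
        rw [Measure.addHaar_closedBall_mul_of_pos _ _ (inv_pos.2 hε), finrank_euclideanSpace_fin,
          mul_left_comm, ← mul_assoc (ENNReal.ofReal _), ← ENNReal.ofReal_mul hpow.le, inv_pow,
          mul_inv_cancel₀ hpow.ne', ENNReal.ofReal_one, one_mul]

theorem tendsto_integral_norm_sub_translate {d : ℕ} {ψ : Rd d → ℝ} (hψ : Integrable ψ) :
    Tendsto (fun t : Rd d => ∫ x, ‖ψ x - ψ (x - t)‖) (𝓝 0) (𝓝 0) := by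
  set F : Lp ℝ 1 (volume : Measure (Rd d)) := (memLp_one_iff_integrable.2 hψ).toLp ψ with hF
  let g : Rd d → C(Rd d, Rd d) :=
    (ContinuousMap.curry ⟨fun q : Rd d × Rd d => q.2 - q.1, by fun_prop⟩ : C(Rd d, C(Rd d, Rd d)))
  have hg : Continuous g := ContinuousMap.continuous _
  have hgm : ∀ t, MeasurePreserving (g t) volume volume :=
    fun t => measurePreserving_sub_right volume t
  have hcont : Continuous fun t => Lp.compMeasurePreserving (g t) (hgm t) F :=
    Continuous.compMeasurePreservingLp continuous_const hg hgm ENNReal.one_ne_top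
  have h0 : ∀ t, ‖F - Lp.compMeasurePreserving (g t) (hgm t) F‖ = ∫ x, ‖ψ x - ψ (x - t)‖ :=
      fun t => by
    rw [L1.norm_eq_integral_norm]
    refine integral_congr_ae ?_
    have hFψ : F =ᵐ[volume] ψ := MemLp.coeFn_toLp _
    filter_upwards [Lp.coeFn_sub F (Lp.compMeasurePreserving (g t) (hgm t) F), hFψ,
      Lp.coeFn_compMeasurePreserving F (hgm t), (hgm t).quasiMeasurePreserving.ae hFψ]
      with x h1 h2 h3 h4
    rw [h1, Pi.sub_apply, h2, h3, Function.comp_apply, h4]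
    rfl
  have h1 : ∫ x, ‖ψ x - ψ (x - 0)‖ = 0 := by simp
  simp only [← h0] at h1 ⊢
  rw [← h1]
  exact (continuous_const.sub hcont).norm.tendsto 0

/-- Rescaled differences of a bounded function converge weakly to zero: the translation by `z`
becomes a translation by `ε z` of the test function, which is continuous in `L¹`. -/
theorem weakL1Tendsto_sub_translate {d : ℕ} {u : Rd d → ℝ} (hu : AEStronglyMeasurable u) {C : ℝ}
    (hC : ∀ x, ‖u x‖ ≤ C) (z : Rd d) {D : Set (Rd d)} (hD : Bornology.IsBounded D)
    (hDm : MeasurableSet D) :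
    WeakL1Tendsto D (fun ε x => u (ε⁻¹ • x) - u (ε⁻¹ • x + z)) fun _ => 0 := by
  have hq1 : ∀ ε : ℝ, 0 < ε → AEStronglyMeasurable fun x : Rd d => u (ε⁻¹ • x) := fun ε hε =>
    hu.comp_quasiMeasurePreserving (Measure.quasiMeasurePreserving_smul _ (inv_ne_zero hε.ne'))
  have hq2 : ∀ ε : ℝ, 0 < ε → AEStronglyMeasurable fun x : Rd d => u (ε⁻¹ • x + z) := fun ε hε =>
    (hu.comp_quasiMeasurePreserving
      (measurePreserving_add_right volume z).quasiMeasurePreserving).comp_quasiMeasurePreserving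
        (Measure.quasiMeasurePreserving_smul _ (inv_ne_zero hε.ne'))
  refine ⟨fun ε hε => ?_, integrableOn_zero, fun φ hφ => ?_⟩
  · refine Measure.integrableOn_of_bounded (M := C + C) hD.measure_lt_top.ne
      ((hq1 ε hε).sub (hq2 ε hε)) (Eventually.of_forall fun x => ?_)
    exact (norm_sub_le _ _).trans (add_le_add (hC _) (hC _))
  have : IsFiniteMeasure (volume.restrict D) := ⟨by simpa using hD.measure_lt_top⟩
  set ψ := D.indicator φ with hψdef
  have hψ : Integrable ψ := (integrable_indicator_iff hDm).2 (hφ.integrable le_top)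
  have hC0 : 0 ≤ C := (norm_nonneg _).trans (hC 0)
  simp only [mul_zero, integral_zero]
  have hlim : Tendsto (fun ε : ℝ => C * ∫ x, ‖ψ x - ψ (x - ε • z)‖) (𝓝[>] 0) (𝓝 0) := by
    have h1 : Tendsto (fun ε : ℝ => ε • z) (𝓝[>] 0) (𝓝 0) := by
      have : Continuous fun ε : ℝ => ε • z := by fun_prop
      simpa using (this.tendsto 0).mono_left nhdsWithin_le_nhds
    simpa using ((tendsto_integral_norm_sub_translate hψ).comp h1).const_mul C
  refine squeeze_zero_norm' ?_ hlim
  filter_upwards [self_mem_nhdsWithin] with ε (hε : 0 < ε)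
  have hi1 : Integrable fun x => ψ x * u (ε⁻¹ • x) :=
    hψ.mul_bdd (hq1 ε hε) (Eventually.of_forall fun x => hC _)
  have hi2 : Integrable fun x => ψ x * u (ε⁻¹ • x + z) :=
    hψ.mul_bdd (hq2 ε hε) (Eventually.of_forall fun x => hC _)
  have hi3 : Integrable fun x => ψ (x - ε • z) * u (ε⁻¹ • x) :=
    (hψ.comp_sub_right _).mul_bdd (hq1 ε hε) (Eventually.of_forall fun x => hC _)
  have e1 : ∫ x in D, φ x * (u (ε⁻¹ • x) - u (ε⁻¹ • x + z)) =
      ∫ x, (ψ x - ψ (x - ε • z)) * u (ε⁻¹ • x) := by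
    rw [← integral_indicator hDm]
    calc ∫ x, D.indicator (fun x => φ x * (u (ε⁻¹ • x) - u (ε⁻¹ • x + z))) x
        = ∫ x, (ψ x * u (ε⁻¹ • x) - ψ x * u (ε⁻¹ • x + z)) := by
          refine integral_congr_ae (Eventually.of_forall fun x => ?_)
          by_cases hx : x ∈ D <;> simp [hψdef, hx, mul_sub]
      _ = (∫ x, ψ x * u (ε⁻¹ • x)) - ∫ x, ψ x * u (ε⁻¹ • x + z) := integral_sub hi1 hi2
      _ = (∫ x, ψ x * u (ε⁻¹ • x)) - ∫ x, ψ (x - ε • z) * u (ε⁻¹ • x) := by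
          rw [← integral_sub_right_eq_self (fun x => ψ x * u (ε⁻¹ • x + z)) (ε • z)]
          simp [smul_sub, smul_smul, inv_mul_cancel₀ hε.ne']
      _ = _ := by
          rw [← integral_sub hi1 hi3]
          simp only [sub_mul]
  rw [e1, ← integral_const_mul]
  refine norm_integral_le_of_norm_le ((hψ.sub (hψ.comp_sub_right _)).norm.const_mul C)
    (Eventually.of_forall fun x => ?_)
  rw [norm_mul, mul_comm]
  exact mul_le_mul_of_nonneg_right (hC _) (norm_nonneg _)

/-! ### The class of observables satisfying the ergodic theorem -/

/-- The ergodic theorem holds for the observable `f`: almost surely, its rescalings along the orbit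
converge weakly in `L¹(D)` to its mean. The exceptional null set depends neither on the test
function nor on the scale. -/
def HasWeakErgodicLimit {d : ℕ} {Ω : Type*} [MeasurableSpace Ω] (P : Measure Ω)
    (τ : Rd d → Ω → Ω) (D : Set (Rd d)) (f : Ω → ℝ) : Prop :=
  ∀ᵐ ω ∂P, WeakL1Tendsto D (fun ε x => f (τ (ε⁻¹ • x) ω)) (fun _ => ∫ ω', f ω' ∂P)

namespace HasWeakErgodicLimit

variable {d : ℕ} {Ω : Type*} [MeasurableSpace Ω] {P : Measure Ω} {τ : Rd d → Ω → Ω}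
  {D : Set (Rd d)}

theorem add {f g : Ω → ℝ} (hfi : Integrable f P) (hgi : Integrable g P)
    (hf : HasWeakErgodicLimit P τ D f) (hg : HasWeakErgodicLimit P τ D g) :
    HasWeakErgodicLimit P τ D (f + g) := by
  filter_upwards [hf, hg] with ω h1 h2
  have := integral_add hfi hgi
  simp only [Pi.add_apply, this]
  exact h1.add h2

theorem const_mul {f : Ω → ℝ} (hf : HasWeakErgodicLimit P τ D f) (c : ℝ) :
    HasWeakErgodicLimit P τ D (fun ω => c * f ω) := by
  filter_upwards [hf] with ω h
  rw [integral_const_mul]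
  exact h.const_mul c

theorem const [IsProbabilityMeasure P] (hD : Bornology.IsBounded D) (c : ℝ) :
    HasWeakErgodicLimit P τ D (fun _ => c) := by
  have hc : IntegrableOn (fun _ : Rd d => c) D := integrableOn_const hD.measure_lt_top.ne
  refine Eventually.of_forall fun ω => ?_
  simp only [integral_const, probReal_univ, one_smul]
  exact ⟨fun _ _ => hc, hc, fun φ _ => tendsto_const_nhds⟩

theorem congr_ae [SFinite P] (hτ : IsMeasurePreservingAction P τ) {f g : Ω → ℝ} (hfg : f =ᵐ[P] g)
    (hf : HasWeakErgodicLimit P τ D f) : HasWeakErgodicLimit P τ D g := by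
  filter_upwards [hf, hτ.ae_ae_orbit hfg] with ω h1 h2
  rw [← integral_congr_ae hfg]
  refine h1.congr_ae fun ε hε => ae_restrict_of_ae ?_
  exact (Measure.quasiMeasurePreserving_smul volume (inv_ne_zero hε.ne')).ae h2

theorem sub_comp [IsFiniteMeasure P] (hτ : IsMeasurePreservingAction P τ)
    (hD : Bornology.IsBounded D) (hDm : MeasurableSet D) {f : Ω → ℝ} (hf : Measurable f) {C : ℝ}
    (hC : ∀ ω, ‖f ω‖ ≤ C) (z : Rd d) :
    HasWeakErgodicLimit P τ D (fun ω => f ω - f (τ z ω)) := by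
  have hmean : ∫ ω, (f ω - f (τ z ω)) ∂P = 0 := by
    have hmp := hτ.measurePreserving z
    have hi : Integrable f P := .of_bound hf.aestronglyMeasurable C (Eventually.of_forall hC)
    have hi' : Integrable (fun ω => f (τ z ω)) P := hmp.integrable_comp_of_integrable hi
    rw [integral_sub hi hi', sub_eq_zero]
    simpa using (hτ.setIntegral_preimage_comp z hf.aestronglyMeasurable MeasurableSet.univ).symm
  refine Eventually.of_forall fun ω => ?_
  rw [hmean]
  convert weakL1Tendsto_sub_translate (u := fun x => f (τ x ω))
    (hτ.aemeasurable_comp_orbit_right hf ω).aestronglyMeasurable (fun x => hC _) z hD hDm using 4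
  simp [hτ.add]

/-- The observables satisfying the ergodic theorem are closed under `L¹` limits. -/
theorem of_tendsto [IsProbabilityMeasure P] (hτ : IsMeasurePreservingAction P τ)
    (hD : Bornology.IsBounded D) {f : Ω → ℝ} (hf : Integrable f P) {s : ℕ → Ω → ℝ}
    (hsi : ∀ k, Integrable (s k) P) (hs : ∀ k, HasWeakErgodicLimit P τ D (s k))
    (hlim : Tendsto (fun k => ∫⁻ ω, ‖f ω - s k ω‖ₑ ∂P) atTop (𝓝 0)) :
    HasWeakErgodicLimit P τ D f := by
  obtain ⟨R₀, hR₀⟩ := hD.subset_closedBall 0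
  set R := max R₀ 1 with hRdef
  have hR : 0 < R := lt_max_of_lt_right one_pos
  have hDR : D ⊆ Metric.closedBall 0 R :=
    hR₀.trans (Metric.closedBall_subset_closedBall (le_max_left _ _))
  -- all exceptional null sets are collected before a test function is chosen
  have hmax := ae_all_iff.2 fun m : ℕ => hτ.ae_exists_forall_lintegral_orbit_le
    (fun k => (hf.sub (hsi k)).aemeasurable.enorm) hlim
    (c := ENNReal.ofReal (1 / (m + 1))) (by simpa using by positivity) m
  have hmean : Tendsto (fun k => ∫ ω, s k ω ∂P) atTop (𝓝 (∫ ω, f ω ∂P)) := by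
    refine tendsto_integral_of_L1 f hf.aestronglyMeasurable (Eventually.of_forall hsi) ?_
    simpa only [enorm_sub_rev] using hlim
  filter_upwards [hmax, ae_all_iff.2 hs, hτ.ae_integrableOn_closedBall hf,
    ae_all_iff.2 fun k => hτ.ae_integrableOn_closedBall (hsi k)] with ω hmax hs hfI hsI
  have hfε : ∀ ε : ℝ, 0 < ε → IntegrableOn (fun x => f (τ (ε⁻¹ • x) ω)) D :=
    fun ε hε => integrableOn_comp_inv_smul (u := fun x => f (τ x ω)) hfI hD hε
  have hconst : ∀ c : ℝ, IntegrableOn (fun _ : Rd d => c) D :=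
    fun _ => integrableOn_const hD.measure_lt_top.ne
  refine ⟨hfε, hconst _, fun φ hφ => ?_⟩
  set K := (eLpNorm φ ⊤ (volume.restrict D)).toReal with hK
  have hK0 : 0 ≤ K := ENNReal.toReal_nonneg
  have hφK : ∀ᵐ x ∂(volume.restrict D), ‖φ x‖ ≤ K := by
    filter_upwards [ae_le_eLpNormEssSup (f := φ) (μ := volume.restrict D)] with x hx
    rw [hK, ← toReal_enorm]
    exact ENNReal.toReal_mono hφ.2.ne (by simpa using hx)
  set V := volume.real (Metric.closedBall (0 : Rd d) (2 * R)) with hV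
  set I := ∫ x in D, φ x with hI
  have hi : ∀ {w : Rd d → ℝ}, IntegrableOn w D → IntegrableOn (fun x => φ x * w x) D :=
    fun hw => Integrable.mul_of_top_right hw hφ
  rw [Metric.tendsto_nhds]
  intro η hη
  have h1 : ∀ᶠ m : ℕ in atTop, K * (V * (1 / (m + 1))) < η / 3 := by
    have : Tendsto (fun m : ℕ => K * (V * (1 / ((m : ℝ) + 1)))) atTop (𝓝 (K * (V * 0))) :=
      (tendsto_one_div_add_atTop_nhds_zero_nat.const_mul V).const_mul K
    exact this.eventually_lt_const (by simpa using by positivity)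
  have h2 : ∀ᶠ m : ℕ in atTop, ∀ k ≥ m,
      dist (I * ∫ ω, s k ω ∂P) (I * ∫ ω, f ω ∂P) < η / 3 := by
    have := Metric.tendsto_nhds.1 (hmean.const_mul I) (η / 3) (by positivity)
    exact eventually_forall_ge_atTop.2 this
  obtain ⟨m, hm1, hm2⟩ := (h1.and h2).exists
  obtain ⟨k, hkm, hk⟩ := hmax m
  have h3 := Metric.tendsto_nhds.1 ((hs k).2.2 φ hφ) (η / 3) (by positivity)
  have hεR : ∀ᶠ ε : ℝ in 𝓝[>] 0, ε ≤ R :=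
    nhdsWithin_le_nhds ((eventually_lt_nhds hR).mono fun _ h => h.le)
  filter_upwards [h3, hεR, self_mem_nhdsWithin] with ε h3 hεR (hε : 0 < ε)
  have hfs : IntegrableOn (fun x => f (τ (ε⁻¹ • x) ω) - s k (τ (ε⁻¹ • x) ω)) D :=
    (hfε ε hε).sub ((hs k).1 ε hε)
  have h4 : dist (∫ x in D, φ x * f (τ (ε⁻¹ • x) ω)) (∫ x in D, φ x * s k (τ (ε⁻¹ • x) ω))
      ≤ K * (V * (1 / (m + 1))) := by
    rw [dist_eq_norm, ← integral_sub (hi (hfε ε hε)) (hi ((hs k).1 ε hε))]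
    have hle := setLIntegral_comp_inv_smul_le
      (h := fun x => ‖f (τ x ω) - s k (τ x ω)‖ₑ) hk hDR hε hεR
    calc ‖∫ x in D, (φ x * f (τ (ε⁻¹ • x) ω) - φ x * s k (τ (ε⁻¹ • x) ω))‖
        ≤ ∫ x in D, K * ‖f (τ (ε⁻¹ • x) ω) - s k (τ (ε⁻¹ • x) ω)‖ := by
          refine norm_integral_le_of_norm_le (hfs.norm.const_mul K) ?_
          filter_upwards [hφK] with x hx
          rw [← mul_sub, norm_mul]
          gcongr
      _ = K * ∫ x in D, ‖f (τ (ε⁻¹ • x) ω) - s k (τ (ε⁻¹ • x) ω)‖ := integral_const_mul _ _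
      _ ≤ K * (V * (1 / (m + 1))) := by
          gcongr
          rw [integral_norm_eq_lintegral_enorm hfs.aestronglyMeasurable]
          refine (ENNReal.toReal_mono
            (ENNReal.mul_lt_top ENNReal.ofReal_lt_top measure_closedBall_lt_top).ne hle).trans ?_
          rw [ENNReal.toReal_mul, ENNReal.toReal_ofReal (by positivity), mul_comm]
          rfl
  have h5 := hm2 k hkm
  simp only [integral_mul_const] at h3 ⊢
  -- the three errors: replacing `f` by `s k` along the orbit, the limit for `s k`, and the means
  calc _ ≤ _ := dist_triangle4 _ (∫ x in D, φ x * s k (τ (ε⁻¹ • x) ω)) (I * ∫ ω, s k ω ∂P) _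
    _ < η / 3 + η / 3 + η / 3 := by
      have := h4.trans_lt hm1
      gcongr
    _ = η := by ring

theorem isClosed_setOf_Lp [IsProbabilityMeasure P] (hτ : IsMeasurePreservingAction P τ)
    (hD : Bornology.IsBounded D) (p : ℝ≥0∞) [Fact (1 ≤ p)] :
    IsClosed {f : Lp ℝ p P | HasWeakErgodicLimit P τ D f} := by
  refine IsSeqClosed.isClosed fun s f hs hlim => ?_
  have hp : 1 ≤ p := Fact.out
  refine of_tendsto hτ hD ((Lp.memLp f).integrable hp)
    (fun k => (Lp.memLp (s k)).integrable hp) hs ?_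
  have h1 := (Lp.tendsto_Lp_iff_tendsto_eLpNorm' s f).1 hlim
  refine tendsto_of_tendsto_of_tendsto_of_le_of_le tendsto_const_nhds h1
    (fun _ => zero_le) fun k => ?_
  have h2 := eLpNorm_le_eLpNorm_of_exponent_le hp
    (((Lp.memLp (s k)).sub (Lp.memLp f)).aestronglyMeasurable)
  refine le_trans (le_of_eq ?_) h2
  rw [eLpNorm_one_eq_lintegral_enorm]
  simp only [Pi.sub_apply, enorm_sub_rev]

/-- The square integrable observables satisfying the ergodic theorem, as a subspace of `L²`. -/
def submodule [IsProbabilityMeasure P] (hτ : IsMeasurePreservingAction P τ)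
    (hD : Bornology.IsBounded D) : Submodule ℝ (Lp ℝ 2 P) where
  carrier := {f | HasWeakErgodicLimit P τ D f}
  zero_mem' := (const hD 0).congr_ae hτ (Lp.coeFn_zero ℝ 2 P).symm
  add_mem' {f g} hf hg := (add ((Lp.memLp f).integrable one_le_two)
    ((Lp.memLp g).integrable one_le_two) hf hg).congr_ae hτ (Lp.coeFn_add f g).symm
  smul_mem' c f hf := (const_mul hf c).congr_ae hτ (Lp.coeFn_smul c f).symm

end HasWeakErgodicLimit

/-! ### Ergodicity and density of the coboundaries -/

theorem IsErgodicAction.ae_eq_const {d : ℕ} {Ω : Type*} [MeasurableSpace Ω] {P : Measure Ω}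
    [IsProbabilityMeasure P] {τ : Rd d → Ω → Ω} (hτ : IsErgodicAction P τ) {f : Ω → ℝ}
    (hf : Measurable f) (hinv : ∀ z, f ∘ τ z =ᵐ[P] f) : ∃ c, f =ᵐ[P] Function.const Ω c := by
  refine exists_eventuallyEq_const_of_forall_separating MeasurableSet fun U hU => ?_
  have hFm : MeasurableSet (f ⁻¹' U) := hf hU
  refine (hτ.ergodic _ hFm fun z => ?_).symm.imp (fun h => ?_) fun h => ?_
  · rw [measure_symmDiff_eq_zero_iff, hτ.image_eq_preimage_neg, ← preimage_comp]
    exact ((hinv (-z)).mono fun x hx => by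
      simp only [mem_preimage, hx]).set_eq
  · exact (mem_ae_iff_prob_eq_one hFm).2 h
  · exact measure_eq_zero_iff_ae_notMem.1 h

namespace HasWeakErgodicLimit

variable {d : ℕ} {Ω : Type*} [MeasurableSpace Ω] {P : Measure Ω} [IsProbabilityMeasure P]
  {τ : Rd d → Ω → Ω} {D : Set (Rd d)}

/-- Mean ergodic theorem: a function orthogonal to the coboundaries `1_F - 1_F ∘ τ_z` is invariant,
hence constant, and being orthogonal to the constants it vanishes. -/
theorem submodule_eq_top (hτ : IsErgodicAction P τ) (hD : Bornology.IsBounded D)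
    (hDm : MeasurableSet D) :
    submodule (D := D) hτ.toIsMeasurePreservingAction hD = ⊤ := by
  set G := submodule (D := D) hτ.toIsMeasurePreservingAction hD with hG
  have hGc : IsClosed (G : Set (Lp ℝ 2 P)) := isClosed_setOf_Lp hτ.toIsMeasurePreservingAction hD 2
  have : CompleteSpace G := hGc.completeSpace_coe
  rw [← Submodule.orthogonal_eq_bot_iff, Submodule.eq_bot_iff]
  intro f hf
  have hfi : Integrable f P := (Lp.memLp f).integrable one_le_two
  have horth : ∀ g : Ω → ℝ, MemLp g 2 P → HasWeakErgodicLimit P τ D g →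
      ∫ ω, g ω * f ω ∂P = 0 := fun g hg2 hg => by
    have hmem : hg2.toLp g ∈ G := hg.congr_ae hτ.toIsMeasurePreservingAction hg2.coeFn_toLp.symm
    have h := (Submodule.mem_orthogonal G f).1 hf _ hmem
    rw [L2.inner_def] at h
    rw [← h]
    refine integral_congr_ae ?_
    filter_upwards [hg2.coeFn_toLp] with ω hω
    simp [hω, mul_comm]
  have hinv : ∀ z, f ∘ τ z =ᵐ[P] f := fun z => by
    have hmp := hτ.measurePreserving z
    have hcomp : Integrable (f ∘ τ z) P := hmp.integrable_comp_of_integrable hfi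
    refine Integrable.ae_eq_of_forall_setIntegral_eq _ _ hcomp hfi fun F hF _ => ?_
    set F' := τ (-z) ⁻¹' F with hF'
    have hF'm : MeasurableSet F' := hτ.measurable (-z) hF
    have hpre : τ z ⁻¹' F' = F := by
      rw [hF', ← preimage_comp, ← hτ.add, add_neg_cancel, hτ.zero, preimage_id]
    have h1 : ∫ ω in F, (f ∘ τ z) ω ∂P = ∫ ω in F', f ω ∂P := by
      rw [← hτ.setIntegral_preimage_comp z hfi.aestronglyMeasurable hF'm, hpre]
      rfl
    have hm : Measurable (F'.indicator fun _ => (1 : ℝ)) := measurable_const.indicator hF'm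
    have hbd : ∀ ω, ‖F'.indicator (fun _ => (1 : ℝ)) ω‖ ≤ 1 := fun ω => by
      by_cases hω : ω ∈ F' <;> simp [hω]
    have hc : ∀ ω, F'.indicator (fun _ => (1 : ℝ)) (τ z ω) = F.indicator (fun _ => 1) ω :=
      fun ω => by rw [← hpre]; rfl
    have h2 := horth _ (MemLp.of_bound
        (hm.sub (hm.comp (hτ.measurable z))).aestronglyMeasurable (1 + 1)
        (Eventually.of_forall fun ω => (norm_sub_le _ _).trans (add_le_add (hbd _) (hbd _))))
      (sub_comp hτ.toIsMeasurePreservingAction hD hDm hm hbd z)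
    have h3 : ∫ ω, (F'.indicator f ω - F.indicator f ω) ∂P = 0 := by
      rw [← h2]
      refine integral_congr_ae (Eventually.of_forall fun ω => ?_)
      simp only [Pi.sub_apply, Function.comp_apply, hc, sub_mul, ← indicator_mul_left, one_mul]
    rw [integral_sub (hfi.indicator hF'm) (hfi.indicator hF), integral_indicator hF'm,
      integral_indicator hF, sub_eq_zero] at h3
    rw [h1, h3]
  obtain ⟨c, hc⟩ := hτ.ae_eq_const (Lp.stronglyMeasurable f).measurable hinv
  have hc0 : c = 0 := by
    have h := horth (fun _ => 1) (memLp_const 1) (const hD 1)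
    simp only [one_mul] at h
    rw [integral_congr_ae hc] at h
    simpa using h
  rw [Lp.eq_zero_iff_ae_eq_zero]
  filter_upwards [hc] with ω hω
  simpa [hc0] using hω

/-- The pointwise ergodic theorem, for all integrable observables. -/
theorem of_integrable (hτ : IsErgodicAction P τ) (hD : Bornology.IsBounded D)
    (hDm : MeasurableSet D) {g : Ω → ℝ} (hg : Integrable g P) : HasWeakErgodicLimit P τ D g := by
  have hτ' := hτ.toIsMeasurePreservingAction
  refine Integrable.induction (HasWeakErgodicLimit P τ D) (fun c F hF _ => ?_)
    (fun f g _ hfi hgi hf hg => hf.add hfi hgi hg) (isClosed_setOf_Lp hτ' hD 1)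
    (fun f g hfg _ hf => hf.congr_ae hτ' hfg) hg
  have hmem : MemLp (F.indicator fun _ => c) 2 P := (memLp_const c).indicator hF
  have htop : hmem.toLp _ ∈ submodule (D := D) hτ' hD := by
    rw [submodule_eq_top hτ hD hDm]
    exact Submodule.mem_top
  exact congr_ae hτ' hmem.coeFn_toLp htop

end HasWeakErgodicLimit

theorem mainTheorem8 {d : ℕ} (hd : 1 ≤ d) {Ω : Type*} [MeasurableSpace Ω] (P : Measure Ω)
    [IsProbabilityMeasure P] (τ : Rd d → Ω → Ω) (hτ : IsErgodicAction P τ)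
    (D : Set (Rd d)) (hDo : IsOpen D) (hDb : Bornology.IsBounded D) :
    (∀ g : Ω → ℝ, Integrable g P →
      ∀ᵐ ω ∂P,
        WeakL1Tendsto D (fun ε x => g (τ (ε⁻¹ • x) ω)) (fun _ => ∫ ω', g ω' ∂P) ∧
        ∀ E : Set (Rd d), E ⊆ D → MeasurableSet E → 0 < volume E →
          Tendsto (fun ε : ℝ => ⨍ x in E, g (τ (ε⁻¹ • x) ω)) (𝓝[>] 0) (𝓝 (∫ ω', g ω' ∂P))) ∧
    (∀ (p : ℝ) (A : Ω → Rd d → Matrix (Fin d) (Fin d) ℝ) (Λ : Ω → Rd d → ℝ),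
      1 < p → IsStationaryWeight P τ p A Λ →
      ∀ᵐ ω ∂P,
        WeakL1Tendsto D (fun ε x => matOpNorm (A ω (ε⁻¹ • x)) ^ p)
          (fun _ => ∫ ω', matOpNorm (A ω' 0) ^ p ∂P) ∧
        WeakL1Tendsto D (fun ε x => matOpNorm ((A ω (ε⁻¹ • x))⁻¹) ^ (p / (p - 1)))
          (fun _ => ∫ ω', matOpNorm ((A ω' 0)⁻¹) ^ (p / (p - 1)) ∂P) ∧
        WeakL1Tendsto D (fun ε x => Λ ω (ε⁻¹ • x)) (fun _ => ∫ ω', Λ ω' 0 ∂P)) := by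
  refine ⟨fun g hg => ?_, fun p A Λ _ hA => ?_⟩
  · filter_upwards [HasWeakErgodicLimit.of_integrable hτ hDb hDo.measurableSet hg] with ω hω
    exact ⟨hω, fun E hED hE hE0 => hω.tendsto_average hDb hED hE hE0⟩
  -- stationarity at `0` turns the weights into observables evaluated along the orbit
  · have hAτ : ∀ ω x, A ω x = A (τ x ω) 0 := fun ω x => by rw [hA.stationary_A, zero_add]
    have hΛτ : ∀ ω x, Λ ω x = Λ (τ x ω) 0 := fun ω x => by rw [hA.stationary_Λ, zero_add]
    filter_upwards [HasWeakErgodicLimit.of_integrable hτ hDb hDo.measurableSet hA.integrable_A,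
      HasWeakErgodicLimit.of_integrable hτ hDb hDo.measurableSet hA.integrable_A_inv,
      HasWeakErgodicLimit.of_integrable hτ hDb hDo.measurableSet hA.integrable_Λ] with ω h1 h2 h3
    simp only [← hAτ] at h1 h2
    simp only [← hΛτ] at h3
    exact ⟨h1, h2, h3⟩
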